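/- Let $N\ge 3$ be odd and $S_N=\{1,\dots,N\}$. Let $E_N$ be the set of subsets of $S_N$ of even cardinality, an $\mathbf F_2$-vector space under symmetric difference (written $+$). Let $E_N^{0,+}$ be the set of $X\in E_N$ such that $N\notin X$ and $X$ has as many even as odd elements; let ${}'E_N^{0,+}$ (resp. ${}''E_N^{0,+}$) be the set of $X\in E_N^{0,+}$ with $N-1\notin X$ (resp. $N-1\in X$). Let $\mathcal P_N$ be the set of all sets $B$ of pairwise disjoint two-element subsets of $S_N$. For $B\in\mathcal P_N$ let $\mathrm{supp}(B)=\bigcup_{\{i,j\}\in B}\{i,j\}$ and let $B^0$ (resp. $B^1$) be the set of $\{i,j\}\in B$ with $i-j$ even (resp. odd). A subset $X$ of $S_N$ is $0$-covered if $X=[a_1,b_1]\sqcup\dots\sqcup[a_r,b_r]$ for some $r\ge0$ and some $\{a_k,b_k\}\in B^1$ with $a_k<b_k$; it is $1$-covered if it is the disjoint union of a $0$-covered set and a one-element set. (Here $[a,b]$ is the set of integers $h$ with $a\le h\le b$, empty if $a>b$.) Let ${}^*\mathcal P_N$ be the set of $B\in\mathcal P_N$ such that, with $s=|B^0|$: $[i+1,j-1]$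 is $0$-covered for every $\{i,j\}\in B^1$ with $i<j$; and there are $i_1<i_2<\dots<i_{2s}$ in $S_N$ with $B^0=\{\{i_{2s},i_1\},\{i_{2s-1},i_2\},\dots,\{i_{s+1},i_s\}\}$ such that $[i_k+1,i_{k+1}-1]$ is $0$-covered for all $k\in[1,2s-1]$, $k\ne s$. Let $\mathcal X_{N-2}^+$ be the set of $B\in{}^*\mathcal P_N$ with $N\notin\mathrm{supp}(B)$ such that either $s=0$, or $s$ is odd and one of the following holds: (i) $[1,i_1-1]$ is $1$-covered and $[i_{2s}+1,N-1]$ is $0$-covered; (ii) $[1,i_1-1]$ is $0$-covered and $[i_{2s}+1,N-1]$ is $1$-covered. If $s$ is odd, let $u_B$ be the unique $u\in[1,i_1-1]$ such that $[1,u-1]$ and $[u+1,i_1-1]$ are $0$-covered in case (i), and the unique $u\in[i_{2s}+1,N-1]$ such that $[i_{2s}+1,u-1]$ and $[u+1,N-1]$ are $0$-covered in case (ii). Let $\mathcal X_{N-2}^-$ be the set of $B\in{}^*\mathcal P_N$ such that either $s=0$ or both $[1,i_1-1]$ and $[i_{2s}+1,N]$ are $0$-covered, and such that $\{i,N\}\in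 B$ for some $i$ with $i\equiv s\pmod 2$. Let $\mathcal X_{N-2}=\mathcal X_{N-2}^+\sqcup\mathcal X_{N-2}^-$. For a two-element subset $\{i,j\}$ of $S_N$ with $i<j$ let $[[\{i,j\}]]=[i,j]$ if $j-i$ is odd and $[[\{i,j\}]]=[j,N]\cup[1,i]$ if $j-i$ is even. Define ${}'\epsilon:\mathcal X_{N-2}\to E_N$ by ${}'\epsilon(B)=\sum_{P\in B}[[P]]$, to which one adds $[u_B,N]$ if $B\in\mathcal X_{N-2}^+$, $|B^0|$ is odd and $u_B$ is even, and adds $\{N\}+[1,u_B]$ if $B\in\mathcal X_{N-2}^+$, $|B^0|$ is odd and $u_B$ is odd. Let $\mathcal X_{N-2}^{0,+}=\{B\in\mathcal X_{N-2}^+: B^0=\emptyset\}$, and let ${}'\mathcal X_{N-2}^{0,+}$ (resp. ${}''\mathcal X_{N-2}^{0,+}$) be the set of $B\in\mathcal X_{N-2}^{0,+}$ with $N-1\notin\mathrm{supp}(B)$ (resp. $N-1\in\mathrm{supp}(B)$). Then ${}'\epsilon$ restricts to a bijection $\mathcal X_{N-2}^{0,+}\to E_N^{0,+}$, and this bijection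 restricts to bijections ${}'\mathcal X_{N-2}^{0,+}\to{}'E_N^{0,+}$ and ${}''\mathcal X_{N-2}^{0,+}\to{}''E_N^{0,+}$. -/

import Mathlib

namespace LusztigBasis

open Finset

/-!
Conventions. `S_N = {1, …, N}` is the finset `Finset.Icc 1 N` of natural numbers, a subset of
`S_N` is a `Finset ℕ` contained in it, and the sum of two subsets is their symmetric difference.
An element of `𝒫_N` is a finite set of pairwise disjoint two-element subsets of `S_N`.
The integer intervals `[i + 1, j - 1]`, `[1, j - 1]`, `[i + 1, j]` are written `Ioo i j`,
`Ico 1 j`, `Ioc i j`.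
-/

/-- `𝒫_N`: sets of pairwise disjoint two-element subsets of `{1, …, N}`. -/
def PN (N : ℕ) : Set (Finset (Finset ℕ)) :=
  {B | (∀ X ∈ B, X ⊆ Icc 1 N ∧ X.card = 2) ∧
    ∀ X ∈ B, ∀ Y ∈ B, X ≠ Y → Disjoint X Y}

/-- `supp(B)`: the union of the pairs in `B`. -/
def supp (B : Finset (Finset ℕ)) : Finset ℕ := B.biUnion id

/-- `B⁰`: the pairs `{i, j}` in `B` with `i - j` even. -/
def B0 (B : Finset (Finset ℕ)) : Finset (Finset ℕ) :=
  B.filter fun X => ∀ i ∈ X, ∀ j ∈ X, Even ((i : ℤ) - (j : ℤ))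

/-- `B¹`: the pairs `{i, j}` in `B` with `i - j` odd. -/
def B1 (B : Finset (Finset ℕ)) : Finset (Finset ℕ) :=
  B.filter fun X => ∃ i ∈ X, ∃ j ∈ X, Odd ((i : ℤ) - (j : ℤ))

/-- `X` is `0`-covered by `B¹`: it is a disjoint union `[a₁, b₁] ⊔ ⋯ ⊔ [a_r, b_r]` (`r ≥ 0`)
with `a_k < b_k` and `{a_k, b_k} ∈ B¹`. -/
def Covered0 (B : Finset (Finset ℕ)) (X : Finset ℕ) : Prop :=
  ∃ (r : ℕ) (a b : Fin r → ℕ),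
    (∀ k, a k < b k ∧ ({a k, b k} : Finset ℕ) ∈ B1 B) ∧
    (∀ k l, k ≠ l → Disjoint (Icc (a k) (b k)) (Icc (a l) (b l))) ∧
    X = univ.biUnion fun k => Icc (a k) (b k)

/-- `X` is `1`-covered by `B¹`: it is the disjoint union of a `0`-covered set and a point. -/
def Covered1 (B : Finset (Finset ℕ)) (X : Finset ℕ) : Prop :=
  ∃ (Y : Finset ℕ) (u : ℕ), Covered0 B Y ∧ u ∉ Y ∧ X = insert u Y

/-- `i` restricted to `{1, …, 2s}`, `s = |B⁰|`, is the sequence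
`i_*(B) = (i₁ < i₂ < ⋯ < i_{2s})` in `S_N` with
`B⁰ = {{i_{2s}, i₁}, {i_{2s-1}, i₂}, …, {i_{s+1}, i_s}}`.
(The values of `i` outside `{1, …, 2s}` are irrelevant.) -/
def IsIStar (N : ℕ) (B : Finset (Finset ℕ)) (i : ℕ → ℕ) : Prop :=
  (∀ k ∈ Icc 1 (2 * (B0 B).card), i k ∈ Icc 1 N) ∧
  (∀ k ∈ Icc 1 (2 * (B0 B).card), ∀ l ∈ Icc 1 (2 * (B0 B).card), k < l → i k < i l) ∧
  B0 B = (Icc 1 (B0 B).card).image fun k => ({i (2 * (B0 B).card + 1 - k), i k} : Finset ℕ)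

/-- `*𝒫_N`. For every pair `i < j` in `B¹` the interval `[i + 1, j - 1]` is `0`-covered, the
sequence `i_*(B)` exists, and the intervals between consecutive terms of it, except the one
between `i_s` and `i_{s+1}`, are `0`-covered. -/
def starPN (N : ℕ) : Set (Finset (Finset ℕ)) :=
  {B | B ∈ PN N ∧
    (∀ i j : ℕ, i < j → ({i, j} : Finset ℕ) ∈ B1 B → Covered0 B (Ioo i j)) ∧
    ∃ i : ℕ → ℕ, IsIStar N B i ∧
      ∀ k ∈ Ico 1 (2 * (B0 B).card), k ≠ (B0 B).card → Covered0 B (Ioo (i k) (i (k + 1)))}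

/-- Condition (i), for the sequence `i`: `[1, i₁ - 1]` is `1`-covered and `[i_{2s} + 1, N - 1]`
is `0`-covered. -/
def CaseI (N : ℕ) (B : Finset (Finset ℕ)) (i : ℕ → ℕ) : Prop :=
  Covered1 B (Ico 1 (i 1)) ∧ Covered0 B (Ioo (i (2 * (B0 B).card)) N)

/-- Condition (ii), for the sequence `i`: `[1, i₁ - 1]` is `0`-covered and
`[i_{2s} + 1, N - 1]` is `1`-covered. -/
def CaseII (N : ℕ) (B : Finset (Finset ℕ)) (i : ℕ → ℕ) : Prop :=
  Covered0 B (Ico 1 (i 1)) ∧ Covered1 B (Ioo (i (2 * (B0 B).card)) N)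

/-- `𝒳_{N-2}^+`. -/
def XPlus (N : ℕ) : Set (Finset (Finset ℕ)) :=
  {B | B ∈ starPN N ∧ N ∉ supp B ∧
    ((B0 B).card = 0 ∨
      (Odd (B0 B).card ∧ ∃ i : ℕ → ℕ, IsIStar N B i ∧ (CaseI N B i ∨ CaseII N B i)))}

/-- `𝒳_{N-2}^-`. -/
def XMinus (N : ℕ) : Set (Finset (Finset ℕ)) :=
  {B | B ∈ starPN N ∧
    ((B0 B).card = 0 ∨
      ∃ i : ℕ → ℕ, IsIStar N B i ∧ Covered0 B (Ico 1 (i 1)) ∧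
        Covered0 B (Ioc (i (2 * (B0 B).card)) N)) ∧
    (Even (B0 B).card → ∃ i : ℕ, Even i ∧ ({i, N} : Finset ℕ) ∈ B) ∧
    (Odd (B0 B).card → ∃ i : ℕ, Odd i ∧ ({i, N} : Finset ℕ) ∈ B)}

/-- `u` is the omitted point `u_B`: in case (i), `u ∈ [1, i₁ - 1]` and `[1, u - 1]`,
`[u + 1, i₁ - 1]` are `0`-covered; in case (ii), `u ∈ [i_{2s} + 1, N - 1]` and
`[i_{2s} + 1, u - 1]`, `[u + 1, N - 1]` are `0`-covered. -/
def IsU (N : ℕ) (B : Finset (Finset ℕ)) (u : ℕ) : Prop :=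
  ∃ i : ℕ → ℕ, IsIStar N B i ∧
    ((CaseI N B i ∧ u ∈ Ico 1 (i 1) ∧ Covered0 B (Ico 1 u) ∧ Covered0 B (Ioo u (i 1))) ∨
     (CaseII N B i ∧ u ∈ Ioo (i (2 * (B0 B).card)) N ∧
        Covered0 B (Ioo (i (2 * (B0 B).card)) u) ∧ Covered0 B (Ioo u N)))

/-- `u_B`, for `B ∈ 𝒳_{N-2}^+` with `|B⁰|` odd. -/
noncomputable def uB (N : ℕ) (B : Finset (Finset ℕ)) : ℕ := Classical.epsilon (IsU N B)

/-- `[[X]]` for a pair `X = {i < j}`: it is `[i, j]` if `j - i` is odd, and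
`[j, N] ∪ [1, i]` if `j - i` is even. -/
def bracket (N : ℕ) (X : Finset ℕ) : Finset ℕ :=
  if h : X.Nonempty then
    if Odd (X.max' h - X.min' h) then Icc (X.min' h) (X.max' h)
    else Icc (X.max' h) N ∪ Icc 1 (X.min' h)
  else ∅

/-- The sum of the `[[X]]`, `X ∈ B`, with respect to symmetric difference. -/
def bracketSum (N : ℕ) (B : Finset (Finset ℕ)) : Finset ℕ :=
  B.fold (fun Y Z => symmDiff Y Z) ∅ (bracket N)

open Classical in
/-- The map `'ε` on `𝒳_{N-2} = 𝒳_{N-2}^+ ⊔ 𝒳_{N-2}^-` (and `∅`, a junk value, elsewhere). -/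
noncomputable def epsPrime (N : ℕ) (B : Finset (Finset ℕ)) : Finset ℕ :=
  if B ∈ XPlus N then
    if (B0 B).card = 0 then bracketSum N B
    else if Even (uB N B) then symmDiff (bracketSum N B) (Icc (uB N B) N)
    else symmDiff (symmDiff (bracketSum N B) (Icc N N)) (Icc 1 (uB N B))
  else if B ∈ XMinus N then bracketSum N B
  else ∅

/-- `E_N`: the subsets of `{1, …, N}` of even cardinality. -/
def EN (N : ℕ) : Set (Finset ℕ) := {X | X ⊆ Icc 1 N ∧ Even X.card}

/-- `γ(X)`: the number of even elements minus the number of odd elements. -/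
def gam (X : Finset ℕ) : ℤ :=
  ((X.filter fun x => Even x).card : ℤ) - ((X.filter fun x => Odd x).card : ℤ)

/-- `E_N^{t,+}`: the `X ∈ E_N` with `γ(X) = t` and `N ∉ X`. -/
def EPlus (N : ℕ) (t : ℤ) : Set (Finset ℕ) := {X | X ∈ EN N ∧ gam X = t ∧ N ∉ X}

/-- `𝒳_{N-2}^{0,+}`. -/
def XZeroPlus (N : ℕ) : Set (Finset (Finset ℕ)) := {B | B ∈ XPlus N ∧ (B0 B).card = 0}

/-- `'𝒳_{N-2}^{0,+}`. -/
def XZeroPlus' (N : ℕ) : Set (Finset (Finset ℕ)) := {B | B ∈ XZeroPlus N ∧ N - 1 ∉ supp B}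

/-- `''𝒳_{N-2}^{0,+}`. -/
def XZeroPlus'' (N : ℕ) : Set (Finset (Finset ℕ)) := {B | B ∈ XZeroPlus N ∧ N - 1 ∈ supp B}

/-- `'E_N^{0,+}`. -/
def EZeroPlus' (N : ℕ) : Set (Finset ℕ) := {X | X ∈ EPlus N 0 ∧ N - 1 ∉ X}

/-- `''E_N^{0,+}`. -/
def EZeroPlus'' (N : ℕ) : Set (Finset ℕ) := {X | X ∈ EPlus N 0 ∧ N - 1 ∈ X}

end LusztigBasis

namespace LusztigBasis

open Finset

/-! When `B⁰` is empty, `B` is a noncrossing system of arcs of odd length on `{1, …, N - 1}` in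
which every point under an arc is matched (`mem_XZeroPlus_iff`), and `'ε(B)` consists of the points
lying under an odd number of closed arcs.

Let the height at `x` be the number of arcs separating `x` from `x + 1`. The number of closed arcs
over `x + 1` is the larger of the heights at `x` and `x + 1`; an unmatched point lies under no arc.
Knowing the height at `x` and whether `x + 1` lies in the image therefore determines the next
height, so the image `X` determines the whole height function `walk X` (`walk_bracketSum`). The
heights determine the arcs, since an arc closes at the first return to the level from which it
opened; this gives injectivity.

Conversely, `walk X` makes sense for every `X`, and its first-return arcs form a nested matching
mapping to `X` as soon as the walk ends at height `0` (`bracketSum_arcs`). An explicit formula for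
`γ` along the walk (`walk_gam`) shows that, `N - 1` being even, this happens exactly when `γ(X) =
0`. The refinement holds because `N - 1`, if matched, closes an outermost arc and so is covered
exactly once. -/

/-! ### Nested matchings and coverings by intervals -/

/-- Matchings of `{1, …, M}` by pairs of odd difference such that the points strictly below
an arc are matched among themselves. -/
structure NestedMatching (M : ℕ) (B : Finset (Finset ℕ)) : Prop where
  pair : ∀ P ∈ B, ∃ i j, 1 ≤ i ∧ i < j ∧ j ≤ M ∧ Odd (j - i) ∧ P = {i, j}
  disj : ∀ P ∈ B, ∀ Q ∈ B, ∀ x ∈ P, x ∈ Q → P = Q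
  nest : ∀ i j, i < j → ({i, j} : Finset ℕ) ∈ B → ∀ a, i < a → a < j →
    ∃ P ∈ B, a ∈ P ∧ ∀ t ∈ P, i < t ∧ t < j

theorem odd_int_sub_iff {i j : ℕ} (h : i < j) : Odd ((i : ℤ) - j) ↔ Odd (j - i) := by
  rw [Int.odd_iff, Nat.odd_iff]; omega

theorem even_int_sub_iff {i j : ℕ} (h : i < j) : Even ((i : ℤ) - j) ↔ Even (j - i) := by
  rw [Int.even_iff, Nat.even_iff]; omega

theorem pair_eq_pair_of_lt {i j a b : ℕ} (h : i < j) (h' : a < b)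
    (e : ({i, j} : Finset ℕ) = {a, b}) : i = a ∧ j = b := by
  have h1 : i ∈ ({a, b} : Finset ℕ) := by rw [← e]; simp
  have h2 : j ∈ ({a, b} : Finset ℕ) := by rw [← e]; simp
  simp only [mem_insert, mem_singleton] at h1 h2
  omega

theorem covered0_empty (B : Finset (Finset ℕ)) : Covered0 B ∅ :=
  ⟨0, Fin.elim0, Fin.elim0, fun k => k.elim0, fun k => k.elim0, by simp⟩

theorem Covered0.union_Icc {B : Finset (Finset ℕ)} {Y : Finset ℕ} (hY : Covered0 B Y) {p k : ℕ}
    (hpk : p < k) (hB : ({p, k} : Finset ℕ) ∈ B1 B) (hd : Disjoint (Icc p k) Y) :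
    Covered0 B (Icc p k ∪ Y) := by
  obtain ⟨r, a, b, h1, h2, rfl⟩ := hY
  rw [disjoint_biUnion_right] at hd
  refine ⟨r + 1, Fin.cons p a, Fin.cons k b, ?_, ?_, ?_⟩
  · intro l
    refine Fin.cases ?_ (fun l => ?_) l
    · simpa using ⟨hpk, hB⟩
    · simpa using h1 l
  · intro l l'
    refine Fin.cases ?_ (fun l => ?_) l <;> refine Fin.cases ?_ (fun l' => ?_) l'
    · simp
    · intro _; simpa using hd l' (mem_univ _)
    · intro _; simpa using (hd l (mem_univ _)).symm
    · intro h; simpa using h2 l l' (fun e => h (by rw [e]))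
  · ext x
    simp [Fin.exists_fin_succ]

namespace NestedMatching

variable {M : ℕ} {B : Finset (Finset ℕ)}

theorem B1_eq (h : NestedMatching M B) : B1 B = B := by
  refine filter_true_of_mem fun P hP => ?_
  obtain ⟨i, j, -, hij, -, ho, rfl⟩ := h.pair P hP
  exact ⟨i, by simp, j, by simp, (odd_int_sub_iff hij).2 ho⟩

theorem B0_eq (h : NestedMatching M B) : B0 B = ∅ := by
  refine filter_false_of_mem fun P hP h0 => ?_
  obtain ⟨i, j, -, hij, -, ho, rfl⟩ := h.pair P hP
  have := (even_int_sub_iff hij).1 (h0 i (by simp) j (by simp))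
  exact Nat.not_even_iff_odd.2 ho this

/-- The arc at `p` is peeled off and the rest is covered by induction; `n` only bounds the length.
-/
theorem covered0_Ico (h : NestedMatching M B) (n : ℕ) : ∀ p q, q ≤ p + n →
    (∀ a, p ≤ a → a < q → ∃ P ∈ B, a ∈ P ∧ ∀ t ∈ P, p ≤ t ∧ t < q) →
    Covered0 B (Ico p q) := by
  induction n with
  | zero =>
    intro p q hq _
    rw [Ico_eq_empty (by omega)]
    exact covered0_empty B
  | succ n ih =>
    intro p q hq hm
    by_cases hpq : q ≤ p
    · rw [Ico_eq_empty (by omega)]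
      exact covered0_empty B
    obtain ⟨P, hP, hpP, hin⟩ := hm p le_rfl (by omega)
    obtain ⟨i, k, -, hik, -, -, rfl⟩ := h.pair P hP
    have hi := hin i (by simp)
    have hk := hin k (by simp)
    -- The partner of `p` is not below `p`, so `p` is the left end of its arc.
    obtain rfl : p = i := by
      simp only [mem_insert, mem_singleton] at hpP
      omega
    have hrest : Covered0 B (Ico (k + 1) q) := by
      refine ih _ _ (by omega) fun a ha haq => ?_
      obtain ⟨Q, hQ, haQ, hQin⟩ := hm a (by omega) haq
      refine ⟨Q, hQ, haQ, fun t ht => ⟨?_, (hQin t ht).2⟩⟩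
      -- An end of `Q` at or before `k` would make `Q` the peeled arc or nest it inside that arc,
      -- while `a` lies beyond `k`.
      by_contra hlt
      have hpt := (hQin t ht).1
      by_cases hend : t = p ∨ t = k
      · have := h.disj Q hQ _ hP t ht (by simpa using hend)
        subst this
        simp only [mem_insert, mem_singleton] at haQ
        omega
      · obtain ⟨R, hR, htR, hRin⟩ := h.nest p k hik hP t (by omega) (by omega)
        obtain rfl := h.disj Q hQ R hR t ht htR
        have := hRin a haQ
        omega
    have hu : Ico p q = Icc p k ∪ Ico (k + 1) q := by
      ext x
      simp only [mem_Ico, mem_union, mem_Icc]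
      omega
    rw [hu]
    refine hrest.union_Icc hik (by rwa [h.B1_eq]) ?_
    rw [disjoint_left]
    intro x
    simp only [mem_Ico, mem_Icc]
    omega

theorem covered0_Ioo (h : NestedMatching M B) {i j : ℕ} (hij : i < j)
    (hB : ({i, j} : Finset ℕ) ∈ B) : Covered0 B (Ioo i j) := by
  have e : Ioo i j = Ico (i + 1) j := by
    ext x
    simp only [mem_Ioo, mem_Ico]
    omega
  rw [e]
  exact h.covered0_Ico j _ _ (by omega) fun a ha haj => h.nest i j hij hB a ha haj

end NestedMatching

/-- A covering only supplies some arc over `a`; descending through the shorter arcs over `a`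
eventually makes `a` an endpoint. -/
theorem exists_pair_of_covered0 {B : Finset (Finset ℕ)}
    (hc : ∀ i j : ℕ, i < j → ({i, j} : Finset ℕ) ∈ B1 B → Covered0 B (Ioo i j)) (n : ℕ) :
    ∀ i j, j ≤ i + n → i < j → ({i, j} : Finset ℕ) ∈ B1 B → ∀ a, i < a → a < j →
      ∃ P ∈ B, a ∈ P ∧ ∀ t ∈ P, i < t ∧ t < j := by
  induction n with
  | zero => intro i j; omega
  | succ n ih =>
    intro i j hn hij hB a hia haj
    obtain ⟨r, p, q, h1, -, h3⟩ := hc i j hij hB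
    have ha : a ∈ Ioo i j := by simp [hia, haj]
    rw [h3, mem_biUnion] at ha
    obtain ⟨k, -, hk⟩ := ha
    have hsub : ∀ t, p k ≤ t → t ≤ q k → i < t ∧ t < j := by
      intro t h h'
      have : t ∈ Ioo i j := by
        rw [h3, mem_biUnion]
        exact ⟨k, mem_univ _, by simp [h, h']⟩
      simpa using this
    have hpq := (h1 k).1
    have hp := hsub (p k) le_rfl hpq.le
    have hq := hsub (q k) hpq.le le_rfl
    rw [mem_Icc] at hk
    by_cases he : a = p k ∨ a = q k
    · refine ⟨_, (mem_filter.1 (h1 k).2).1, by simpa using he, fun t ht => ?_⟩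
      simp only [mem_insert, mem_singleton] at ht
      rcases ht with rfl | rfl
      · exact hp
      · exact hq
    · obtain ⟨P, hP, haP, hin⟩ := ih (p k) (q k) (by omega) hpq (h1 k).2 a (by omega) (by omega)
      refine ⟨P, hP, haP, fun t ht => ?_⟩
      have := hin t ht
      omega

theorem mem_XZeroPlus_iff {N : ℕ} (hN : 1 ≤ N) {B : Finset (Finset ℕ)} :
    B ∈ XZeroPlus N ↔ NestedMatching (N - 1) B := by
  constructor
  · rintro ⟨⟨⟨⟨hpair, hdisj⟩, hc, -⟩, hNs, -⟩, h0⟩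
    have hpair' : ∀ P ∈ B, ∃ i j, 1 ≤ i ∧ i < j ∧ j ≤ N - 1 ∧ Odd (j - i) ∧ P = {i, j} := by
      intro P hP
      obtain ⟨hsub, hcard⟩ := hpair P hP
      obtain ⟨x, y, hxy, rfl⟩ := card_eq_two.1 hcard
      have key : ∀ i j, i < j → ({x, y} : Finset ℕ) = {i, j} →
          ∃ i j, 1 ≤ i ∧ i < j ∧ j ≤ N - 1 ∧ Odd (j - i) ∧ ({x, y} : Finset ℕ) = {i, j} := by
        intro i j hij e
        rw [e] at hP hsub
        have hi := mem_Icc.1 (hsub (show i ∈ ({i, j} : Finset ℕ) by simp))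
        have hj := mem_Icc.1 (hsub (show j ∈ ({i, j} : Finset ℕ) by simp))
        have hjN : j ≠ N := by
          rintro rfl
          exact hNs (mem_biUnion.2 ⟨_, hP, by simp⟩)
        refine ⟨i, j, hi.1, hij, by omega, ?_, e⟩
        by_contra ho
        rw [Nat.not_odd_iff_even] at ho
        have : ({i, j} : Finset ℕ) ∈ B0 B := by
          refine mem_filter.2 ⟨hP, fun s hs t ht => ?_⟩
          simp only [mem_insert, mem_singleton] at hs ht
          rw [Nat.even_iff] at ho
          rw [Int.even_iff]
          omega
        rw [card_eq_zero] at h0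
        simp [h0] at this
      rcases lt_or_gt_of_ne hxy with h | h
      · exact key x y h rfl
      · exact key y x h (pair_comm x y)
    refine ⟨hpair', ?_, ?_⟩
    · intro P hP Q hQ x hx hx'
      by_contra hne
      exact disjoint_left.1 (hdisj P hP Q hQ hne) hx hx'
    · intro i j hij hB
      refine exists_pair_of_covered0 hc j i j (by omega) hij ?_
      obtain ⟨i', j', -, hij', -, ho, e⟩ := hpair' _ hB
      obtain ⟨rfl, rfl⟩ := pair_eq_pair_of_lt hij hij' e
      exact mem_filter.2 ⟨hB, i, by simp, j, by simp, (odd_int_sub_iff hij).2 ho⟩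
  · intro h
    have h0 : (B0 B).card = 0 := by simp [h.B0_eq]
    refine ⟨⟨⟨⟨?_, ?_⟩, ?_, ?_⟩, ?_, Or.inl h0⟩, h0⟩
    · intro P hP
      obtain ⟨i, j, h1, hij, hj, -, rfl⟩ := h.pair P hP
      refine ⟨?_, card_pair hij.ne⟩
      intro x
      simp only [mem_insert, mem_singleton, mem_Icc]
      omega
    · intro P hP Q hQ hne
      exact disjoint_left.2 fun x hx hx' => hne (h.disj P hP Q hQ x hx hx')
    · intro i j hij hB
      rw [h.B1_eq] at hB
      exact h.covered0_Ioo hij hB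
    -- For `s = 0` every condition on the sequence is vacuous, so any function serves.
    · refine ⟨id, ⟨?_, ?_, ?_⟩, ?_⟩
      · simp [h0]
      · simp [h0]
      · simp [h.B0_eq]
      · simp [h0]
    · intro hs
      obtain ⟨P, hP, hNP⟩ := mem_biUnion.1 hs
      obtain ⟨i, j, h1, hij, hj, -, rfl⟩ := h.pair P hP
      simp only [id, mem_insert, mem_singleton] at hNP
      omega

/-! ### Counting the arcs over a point and over a gap -/

/-- The pairs of `B` separated by `x + 1/2`. -/
def straddle (B : Finset (Finset ℕ)) (x : ℕ) : Finset (Finset ℕ) :=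
  B.filter fun P => (∃ i ∈ P, i ≤ x) ∧ ∃ j ∈ P, x < j

/-- The pairs of `B` whose convex hull contains `x`. -/
def cover (B : Finset (Finset ℕ)) (x : ℕ) : Finset (Finset ℕ) :=
  B.filter fun P => (∃ i ∈ P, i ≤ x) ∧ ∃ j ∈ P, x ≤ j

theorem mem_straddle_pair {B : Finset (Finset ℕ)} {x i j : ℕ} (hij : i < j) :
    ({i, j} : Finset ℕ) ∈ straddle B x ↔ ({i, j} : Finset ℕ) ∈ B ∧ i ≤ x ∧ x < j := by
  simp only [straddle, mem_filter, mem_insert, mem_singleton, exists_eq_or_imp, exists_eq_left]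
  refine and_congr_right fun _ => ?_
  omega

theorem mem_cover_pair {B : Finset (Finset ℕ)} {x i j : ℕ} (hij : i < j) :
    ({i, j} : Finset ℕ) ∈ cover B x ↔ ({i, j} : Finset ℕ) ∈ B ∧ i ≤ x ∧ x ≤ j := by
  simp only [cover, mem_filter, mem_insert, mem_singleton, exists_eq_or_imp, exists_eq_left]
  refine and_congr_right fun _ => ?_
  omega

theorem mem_bracketSum_iff_odd_filter (N : ℕ) (B : Finset (Finset ℕ)) (x : ℕ) :
    x ∈ bracketSum N B ↔ Odd (B.filter fun P => x ∈ bracket N P).card := by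
  rw [bracketSum]
  induction B using Finset.induction_on with
  | empty => simp
  | insert P B hP ih =>
    rw [fold_insert hP, filter_insert, mem_symmDiff, ih]
    by_cases h : x ∈ bracket N P
    · rw [if_pos h, card_insert_of_notMem (by simp [hP]), Nat.odd_add_one]
      tauto
    · rw [if_neg h]
      tauto

namespace NestedMatching

variable {M : ℕ} {B : Finset (Finset ℕ)}

theorem ext_of_pairs (h : NestedMatching M B) {S T : Finset (Finset ℕ)} (hS : S ⊆ B) (hT : T ⊆ B)
    (H : ∀ i j, i < j → ({i, j} : Finset ℕ) ∈ B →
      (({i, j} : Finset ℕ) ∈ S ↔ ({i, j} : Finset ℕ) ∈ T)) : S = T := by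
  ext P
  by_cases hP : P ∈ B
  · obtain ⟨i, j, -, hij, -, -, rfl⟩ := h.pair P hP
    exact H i j hij hP
  · exact ⟨fun hh => absurd (hS hh) hP, fun hh => absurd (hT hh) hP⟩

theorem pair_inj (h : NestedMatching M B) {i j a b x : ℕ} (hij : i < j) (hab : a < b)
    (h1 : ({i, j} : Finset ℕ) ∈ B) (h2 : ({a, b} : Finset ℕ) ∈ B) (hx : x = i ∨ x = j)
    (hx' : x = a ∨ x = b) : i = a ∧ j = b :=
  pair_eq_pair_of_lt hij hab (h.disj _ h1 _ h2 x (by simpa using hx) (by simpa using hx'))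

theorem mem_bracketSum_iff (h : NestedMatching M B) (N x : ℕ) :
    x ∈ bracketSum N B ↔ Odd (cover B x).card := by
  rw [mem_bracketSum_iff_odd_filter, cover]
  have : (B.filter fun P => x ∈ bracket N P) =
      B.filter fun P => (∃ i ∈ P, i ≤ x) ∧ ∃ j ∈ P, x ≤ j := by
    refine filter_congr fun P hP => ?_
    obtain ⟨i, j, -, hij, -, ho, rfl⟩ := h.pair P hP
    have hmax : ∀ hn, ({i, j} : Finset ℕ).max' hn = j := fun hn =>
      le_antisymm (max'_le _ _ _ (by simp [hij.le])) (le_max' _ _ (by simp))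
    have hmin : ∀ hn, ({i, j} : Finset ℕ).min' hn = i := fun hn =>
      le_antisymm (min'_le _ _ (by simp)) (le_min' _ _ _ (by simp [hij.le]))
    rw [bracket, dif_pos (by simp)]
    simp only [hmax, hmin, if_pos ho, mem_Icc, mem_insert, mem_singleton, exists_eq_or_imp,
      exists_eq_left]
    omega
  rw [this]

theorem cover_of_notMem_supp (h : NestedMatching M B) {x : ℕ} (hx : x + 1 ∉ supp B) :
    cover B (x + 1) = straddle B x ∧ straddle B (x + 1) = straddle B x := by
  have aux : ∀ i j, ({i, j} : Finset ℕ) ∈ B → x + 1 ≠ i ∧ x + 1 ≠ j := by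
    intro i j hB
    constructor <;> rintro rfl <;> exact hx (mem_biUnion.2 ⟨_, hB, by simp⟩)
  constructor
  · refine h.ext_of_pairs (filter_subset _ _) (filter_subset _ _) fun i j hij hB => ?_
    have := aux i j hB
    rw [mem_cover_pair hij, mem_straddle_pair hij]
    refine and_congr_right fun _ => ?_
    omega
  · refine h.ext_of_pairs (filter_subset _ _) (filter_subset _ _) fun i j hij hB => ?_
    have := aux i j hB
    rw [mem_straddle_pair hij, mem_straddle_pair hij]
    refine and_congr_right fun _ => ?_
    omega

theorem card_of_opening (h : NestedMatching M B) {x k : ℕ} (hk : x + 1 < k)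
    (hB : ({x + 1, k} : Finset ℕ) ∈ B) :
    (cover B (x + 1)).card = (straddle B x).card + 1 ∧
      (straddle B (x + 1)).card = (straddle B x).card + 1 := by
  have hn : ({x + 1, k} : Finset ℕ) ∉ straddle B x := by
    rw [mem_straddle_pair hk]; omega
  have hs : insert {x + 1, k} (straddle B x) ⊆ B :=
    insert_subset hB (filter_subset _ _)
  have aux : ∀ i j, i < j → ({i, j} : Finset ℕ) ∈ B → (x + 1 = i ∨ x + 1 = j) →
      x + 1 = i ∧ k = j := fun i j hij hB' hx => h.pair_inj hk hij hB hB' (Or.inl rfl) hx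
  rw [← card_insert_of_notMem hn]
  constructor <;> congr 1
  · refine h.ext_of_pairs (filter_subset _ _) hs fun i j hij hB' => ?_
    have := aux i j hij hB'
    rw [mem_insert, mem_cover_pair hij, mem_straddle_pair hij]
    constructor
    · rintro ⟨-, h1, h2⟩
      by_cases he : x + 1 = i ∨ x + 1 = j
      · obtain ⟨rfl, rfl⟩ := this he; exact Or.inl rfl
      · exact Or.inr ⟨hB', by omega, by omega⟩
    · rintro (e | ⟨-, h1, h2⟩)
      · obtain ⟨rfl, rfl⟩ := pair_eq_pair_of_lt hij hk e
        exact ⟨hB', by omega, by omega⟩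
      · exact ⟨hB', by omega, by omega⟩
  · refine h.ext_of_pairs (filter_subset _ _) hs fun i j hij hB' => ?_
    have := aux i j hij hB'
    rw [mem_insert, mem_straddle_pair hij, mem_straddle_pair hij]
    constructor
    · rintro ⟨-, h1, h2⟩
      by_cases he : x + 1 = i ∨ x + 1 = j
      · obtain ⟨rfl, rfl⟩ := this he; exact Or.inl rfl
      · exact Or.inr ⟨hB', by omega, by omega⟩
    · rintro (e | ⟨-, h1, h2⟩)
      · obtain ⟨rfl, rfl⟩ := pair_eq_pair_of_lt hij hk e
        exact ⟨hB', by omega, by omega⟩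
      · exact ⟨hB', by omega, by omega⟩

theorem card_of_closing (h : NestedMatching M B) {x k : ℕ} (hk : k < x + 1)
    (hB : ({k, x + 1} : Finset ℕ) ∈ B) :
    (cover B (x + 1)).card = (straddle B x).card ∧
      (straddle B x).card = (straddle B (x + 1)).card + 1 := by
  have hn : ({k, x + 1} : Finset ℕ) ∉ straddle B (x + 1) := by
    rw [mem_straddle_pair hk]; omega
  have hs : insert {k, x + 1} (straddle B (x + 1)) ⊆ B :=
    insert_subset hB (filter_subset _ _)
  have aux : ∀ i j, i < j → ({i, j} : Finset ℕ) ∈ B → (x + 1 = i ∨ x + 1 = j) →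
      k = i ∧ x + 1 = j := fun i j hij hB' hx => h.pair_inj hk hij hB hB' (Or.inr rfl) hx
  rw [← card_insert_of_notMem hn]
  constructor <;> congr 1
  · refine h.ext_of_pairs (filter_subset _ _) (filter_subset _ _) fun i j hij hB' => ?_
    have := aux i j hij hB'
    rw [mem_cover_pair hij, mem_straddle_pair hij]
    refine and_congr_right fun _ => ?_
    omega
  · refine h.ext_of_pairs (filter_subset _ _) hs fun i j hij hB' => ?_
    have := aux i j hij hB'
    rw [mem_insert, mem_straddle_pair hij, mem_straddle_pair hij]
    constructor
    · rintro ⟨-, h1, h2⟩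
      by_cases he : x + 1 = i ∨ x + 1 = j
      · obtain ⟨rfl, rfl⟩ := this he; exact Or.inl rfl
      · exact Or.inr ⟨hB', by omega, by omega⟩
    · rintro (e | ⟨-, h1, h2⟩)
      · obtain ⟨rfl, rfl⟩ := pair_eq_pair_of_lt hij hk e
        exact ⟨hB', by omega, by omega⟩
      · exact ⟨hB', by omega, by omega⟩

theorem opening_or_closing (h : NestedMatching M B) {x : ℕ} (hx : x ∈ supp B) :
    (∃ k, x < k ∧ ({x, k} : Finset ℕ) ∈ B) ∨ ∃ k, k < x ∧ ({k, x} : Finset ℕ) ∈ B := by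
  obtain ⟨P, hP, hxP⟩ := mem_biUnion.1 hx
  obtain ⟨i, j, -, hij, -, -, rfl⟩ := h.pair P hP
  simp only [id, mem_insert, mem_singleton] at hxP
  rcases hxP with rfl | rfl
  · exact Or.inl ⟨j, hij, hP⟩
  · exact Or.inr ⟨i, hij, hP⟩

theorem straddle_of_notMem_supp (h : NestedMatching M B) {x : ℕ} (hx : x ∉ supp B) :
    straddle B x = ∅ := by
  rw [eq_empty_iff_forall_notMem]
  intro P hP
  have hPB : P ∈ B := (mem_filter.1 hP).1
  obtain ⟨i, j, -, hij, -, -, rfl⟩ := h.pair P hPB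
  rw [mem_straddle_pair hij] at hP
  have hxi : i ≠ x := by
    rintro rfl
    exact hx (mem_biUnion.2 ⟨_, hPB, by simp⟩)
  obtain ⟨Q, hQ, hxQ, -⟩ := h.nest i j hij hPB x (by omega) (by omega)
  exact hx (mem_biUnion.2 ⟨Q, hQ, hxQ⟩)

theorem straddle_eq_empty (h : NestedMatching M B) {x : ℕ} (hx : x = 0 ∨ M ≤ x) :
    straddle B x = ∅ := by
  rw [eq_empty_iff_forall_notMem]
  intro P hP
  obtain ⟨i, j, hi, hij, hj, -, rfl⟩ := h.pair P (mem_filter.1 hP).1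
  rw [mem_straddle_pair hij] at hP
  omega

end NestedMatching

/-! ### The height walk and injectivity -/

/-- The lattice path attached to `X`. Its value at `x` is the number of pairs separated by
`x + 1/2` in the nested matching that maps to `X`. -/
def walk (X : Finset ℕ) : ℕ → ℕ
  | 0 => 0
  -- Membership matching the parity of the current height means that no arc opens. Truncated
  -- subtraction keeps the walk at `0` there, which encodes an unmatched point.
  | x + 1 => if (x + 1 ∈ X ↔ Odd (walk X x)) then walk X x - 1 else walk X x + 1

theorem walk_bracketSum {M : ℕ} {B : Finset (Finset ℕ)} (h : NestedMatching M B) (N x : ℕ) :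
    walk (bracketSum N B) x = (straddle B x).card := by
  induction x with
  | zero => simp [walk, h.straddle_eq_empty (Or.inl rfl)]
  | succ x ih =>
    simp only [walk, ih, h.mem_bracketSum_iff]
    by_cases hx : x + 1 ∈ supp B
    · rcases h.opening_or_closing hx with ⟨k, hk, hB⟩ | ⟨k, hk, hB⟩
      · obtain ⟨h1, h2⟩ := h.card_of_opening hk hB
        rw [h1, h2, if_neg]
        rw [Nat.odd_add_one]
        tauto
      · obtain ⟨h1, h2⟩ := h.card_of_closing hk hB
        rw [h1, if_pos Iff.rfl]
        omega
    · obtain ⟨h1, h2⟩ := h.cover_of_notMem_supp hx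
      have h3 := h.straddle_of_notMem_supp hx
      rw [h1, ← h2, h3]
      simp

/-- The counts recover the arcs: a rise marks an opening, and the arc closes at the first return to
the earlier count. -/
theorem NestedMatching.subset_of_straddle {M : ℕ} {B C : Finset (Finset ℕ)}
    (hB : NestedMatching M B) (hC : NestedMatching M C)
    (H : ∀ x, (straddle B x).card = (straddle C x).card) : B ⊆ C := by
  have key : ∀ {D : Finset (Finset ℕ)}, NestedMatching M D → ∀ x j, x + 1 < j →
      ({x + 1, j} : Finset ℕ) ∈ D → (straddle D j).card = (straddle D x).card ∧
        ∀ t, x + 1 ≤ t → t < j → (straddle D x).card < (straddle D t).card := by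
    intro D hD x j hj hP
    have nc : ∀ a b, a < b → ({a, b} : Finset ℕ) ∈ D → ∀ t, t = a ∨ t = b → x + 1 < t → t < j →
        x + 1 < a ∧ b < j := by
      intro a b hab hQ t ht h1 h2
      obtain ⟨R, hR, htR, hin⟩ := hD.nest _ _ hj hP t h1 h2
      obtain rfl := hD.disj _ hQ R hR t (by simpa using ht) htR
      exact ⟨(hin a (by simp)).1, (hin b (by simp)).2⟩
    have inj : ∀ a b, a < b → ({a, b} : Finset ℕ) ∈ D → ∀ t, t = x + 1 ∨ t = j →
        t = a ∨ t = b → x + 1 = a ∧ j = b := fun a b hab hQ t h1 h2 =>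
      hD.pair_inj hj hab hP hQ h1 h2
    constructor
    · congr 1
      refine hD.ext_of_pairs (filter_subset _ _) (filter_subset _ _) fun a b hab hQ => ?_
      rw [mem_straddle_pair hab, mem_straddle_pair hab]
      refine and_congr_right fun _ => ?_
      have h1 := nc a b hab hQ a (Or.inl rfl)
      have h2 := nc a b hab hQ b (Or.inr rfl)
      have h3 := inj a b hab hQ (x + 1) (Or.inl rfl)
      have h4 := inj a b hab hQ j (Or.inr rfl)
      omega
    · intro t h1 h2
      have hn : ({x + 1, j} : Finset ℕ) ∉ straddle D x := by
        rw [mem_straddle_pair hj]; omega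
      have : insert {x + 1, j} (straddle D x) ⊆ straddle D t := by
        refine insert_subset ((mem_straddle_pair hj).2 ⟨hP, h1, h2⟩) fun Q hQ => ?_
        have hQD := (mem_filter.1 hQ).1
        obtain ⟨a, b, -, hab, -, -, rfl⟩ := hD.pair Q hQD
        rw [mem_straddle_pair hab] at hQ ⊢
        have h2 := nc a b hab hQD b (Or.inr rfl)
        have h3 := inj a b hab hQD (x + 1) (Or.inl rfl)
        have h4 := inj a b hab hQD j (Or.inr rfl)
        refine ⟨hQD, by omega, by omega⟩
      have := card_le_card this
      rw [card_insert_of_notMem hn] at this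
      omega
  intro P hP
  obtain ⟨i, j, hi, hij, hj, -, rfl⟩ := hB.pair P hP
  obtain ⟨x, rfl⟩ : ∃ x, i = x + 1 := ⟨i - 1, by omega⟩
  obtain ⟨b1, b2⟩ := key hB x j hij hP
  have hup := H (x + 1)
  have hx := H x
  have hbup := b2 (x + 1) le_rfl hij
  have hmem : x + 1 ∈ supp C := by
    by_contra hn
    have := (hC.cover_of_notMem_supp hn).2
    rw [this] at hup
    omega
  rcases hC.opening_or_closing hmem with ⟨k, hk, hQ⟩ | ⟨k, hk, hQ⟩
  · obtain ⟨c1, c2⟩ := key hC x k hk hQ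
    have : j = k := by
      rcases lt_trichotomy j k with hjk | hjk | hjk
      · have := c2 j hij.le hjk
        have := H j
        omega
      · exact hjk
      · have := b2 k hk.le hjk
        have := H k
        omega
    rwa [this]
  · have := (hC.card_of_closing hk hQ).2
    omega

theorem NestedMatching.bracketSum_inj {M : ℕ} {B C : Finset (Finset ℕ)} {N : ℕ}
    (hB : NestedMatching M B) (hC : NestedMatching M C) (e : bracketSum N B = bracketSum N C) :
    B = C := by
  have H : ∀ x, (straddle B x).card = (straddle C x).card := fun x => by
    rw [← walk_bracketSum hB N, ← walk_bracketSum hC N, e]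
  exact (hB.subset_of_straddle hC H).antisymm (hC.subset_of_straddle hB fun x => (H x).symm)

/-! ### The invariant `γ` and the final height -/

theorem gam_eq_sum (X : Finset ℕ) : gam X = ∑ x ∈ X, if Even x then (1 : ℤ) else -1 := by
  rw [gam, sum_ite]
  simp [Nat.not_even_iff_odd, sub_eq_add_neg]

theorem gam_filter_le_succ (X : Finset ℕ) (x : ℕ) :
    gam (X.filter fun t => t ≤ x + 1) = gam (X.filter fun t => t ≤ x) +
      if x + 1 ∈ X then (if Even (x + 1) then 1 else -1) else 0 := by
  simp only [gam_eq_sum]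
  by_cases h : x + 1 ∈ X
  · have : (X.filter fun t => t ≤ x + 1) = insert (x + 1) (X.filter fun t => t ≤ x) := by
      ext t
      simp only [mem_filter, mem_insert]
      constructor
      · rintro ⟨h1, h2⟩
        rcases Nat.lt_or_ge x t with h3 | h3
        · left; omega
        · exact Or.inr ⟨h1, h3⟩
      · rintro (rfl | ⟨h1, h2⟩)
        · exact ⟨h, le_rfl⟩
        · exact ⟨h1, by omega⟩
    rw [this, sum_insert (by simp), if_pos h, add_comm]
  · have : (X.filter fun t => t ≤ x + 1) = X.filter fun t => t ≤ x := by
      refine filter_congr fun t ht => ?_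
      have : t ≠ x + 1 := by rintro rfl; exact h ht
      omega
    rw [this, if_neg h, add_zero]

/-- The parities of position and height fix the sign, and `γ` of the initial segment is half the
height up to rounding. At even `x` it vanishes only at height `0`. -/
theorem walk_gam (X : Finset ℕ) (h0 : 0 ∉ X) (x : ℕ) :
    2 * gam (X.filter fun t => t ≤ x) =
      if Even x then (if Even (walk X x) then -(walk X x : ℤ) else 1 + walk X x)
      else (if Even (walk X x) then (walk X x : ℤ) else -1 - walk X x) := by
  induction x with
  | zero =>
    have : (X.filter fun t => t ≤ 0) = ∅ := by
      rw [filter_eq_empty_iff]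
      intro t ht h
      obtain rfl : t = 0 := by omega
      exact h0 ht
    rw [this]
    simp [walk, gam]
  | succ x ih =>
    rw [gam_filter_le_succ, mul_add, ih, walk]
    generalize walk X x = m
    simp only [Nat.even_iff, Nat.odd_iff]
    by_cases hX : x + 1 ∈ X <;> simp only [hX, true_iff, false_iff, if_true, if_false] <;>
      split_ifs <;> omega

theorem walk_eq_zero_iff {X : Finset ℕ} {M : ℕ} (hM : Even M) (hX : X ⊆ Icc 1 M) :
    walk X M = 0 ↔ gam X = 0 := by
  have h0 : 0 ∉ X := fun h => by simpa using hX h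
  have hf : (X.filter fun t => t ≤ M) = X :=
    filter_true_of_mem fun t ht => (mem_Icc.1 (hX ht)).2
  have := walk_gam X h0 M
  rw [hf, if_pos hM] at this
  split_ifs at this <;> omega

theorem even_card_of_gam_eq_zero {X : Finset ℕ} (h : gam X = 0) : Even X.card := by
  have := card_filter_add_card_filter_not (s := X) (fun x => Even x)
  simp only [Nat.not_even_iff_odd] at this
  rw [gam] at h
  exact ⟨(X.filter fun x => Even x).card, by omega⟩

/-! ### Reconstructing the matching from the walk -/

theorem walk_succ (X : Finset ℕ) (x : ℕ) :
    (walk X (x + 1) = walk X x + 1 ∧ (x + 1 ∈ X ↔ Odd (walk X x + 1))) ∨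
    (walk X x = walk X (x + 1) + 1 ∧ (x + 1 ∈ X ↔ Odd (walk X x))) ∨
    (walk X x = 0 ∧ walk X (x + 1) = 0 ∧ x + 1 ∉ X) := by
  rw [walk]
  split_ifs with h
  · rcases Nat.eq_zero_or_pos (walk X x) with h0 | h0
    · rw [h0] at h
      exact Or.inr (Or.inr ⟨h0, by omega, by simpa using h⟩)
    · exact Or.inr (Or.inl ⟨by omega, h⟩)
  · refine Or.inl ⟨rfl, ?_⟩
    rw [Nat.odd_add_one]
    tauto

/-- `j` is the first return of the walk to its level before the up-step at `i`. -/
def IsArc (X : Finset ℕ) (i j : ℕ) : Prop :=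
  1 ≤ i ∧ i < j ∧ walk X j = walk X (i - 1) ∧ ∀ t, i ≤ t → t < j → walk X (i - 1) < walk X t

namespace IsArc

variable {X : Finset ℕ} {i j a b : ℕ}

/-- If `i < a`, the inner base level is above the outer one, so the walk cannot reach the outer
level at `j` before the inner arc has closed. -/
theorem nested (h : IsArc X i j) (h' : IsArc X a b) (h1 : i ≤ a) (h2 : a ≤ j) :
    (a = i ∧ b = j) ∨ (i < a ∧ b < j) := by
  obtain ⟨hi, hij, hw, ht⟩ := h
  obtain ⟨ha, hab, hw', ht'⟩ := h'
  rcases h1.eq_or_lt with rfl | h1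
  · left
    refine ⟨rfl, ?_⟩
    rcases lt_trichotomy b j with hb | hb | hb
    · have := ht b hab.le hb; omega
    · exact hb
    · have := ht' j hij.le hb; omega
  · right
    refine ⟨h1, ?_⟩
    have hp := ht (a - 1) (by omega) (by omega)
    rcases lt_trichotomy b j with hb | hb | hb
    · exact hb
    · subst hb; omega
    · have := ht' j h2 hb; omega

theorem eq_of_common (h : IsArc X i j) (h' : IsArc X a b) {x : ℕ} (hx : x = i ∨ x = j)
    (hx' : x = a ∨ x = b) : a = i ∧ b = j := by
  have := h.2.1
  have := h'.2.1
  rcases le_total i a with hia | hia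
  · have := h.nested h' hia (by omega)
    omega
  · have := h'.nested h hia (by omega)
    omega

/-- Flat steps occur only at height `0`, so from `i - 1` to `j` every step is `±1`; returning to the
same level takes an even number of them. -/
theorem odd_sub (h : IsArc X i j) : Odd (j - i) := by
  obtain ⟨hi, hij, hw, ht⟩ := h
  have key : ∀ n, i - 1 + n ≤ j → (walk X (i - 1 + n) + n) % 2 = walk X (i - 1) % 2 := by
    intro n
    induction n with
    | zero => simp
    | succ n ih =>
      intro hn
      have := ih (by omega)
      rw [← add_assoc (i - 1) n 1]
      rcases walk_succ X (i - 1 + n) with ⟨h, -⟩ | ⟨h, -⟩ | ⟨h, h', -⟩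
      · omega
      · omega
      · exfalso
        rcases Nat.eq_zero_or_pos n with rfl | hn0
        · have := ht i le_rfl hij
          have e : i - 1 + 0 + 1 = i := by omega
          rw [e] at h'
          omega
        · have := ht (i - 1 + n) (by omega) (by omega)
          omega
  have := key (j - (i - 1)) (by omega)
  rw [show i - 1 + (j - (i - 1)) = j by omega, hw] at this
  rw [Nat.odd_iff]
  omega

end IsArc

theorem exists_isArc_of_up {X : Finset ℕ} {M x : ℕ} (hM : walk X M = 0) (hx : x < M)
    (hup : walk X (x + 1) = walk X x + 1) : ∃ j ≤ M, IsArc X (x + 1) j := by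
  -- The first such `j` lies exactly at the starting level, since the walk descends by at most one.
  have hex : ∃ j, x + 1 ≤ j ∧ walk X j ≤ walk X x := ⟨M, hx, by omega⟩
  have hs := Nat.find_spec hex
  have hmin := fun t => Nat.find_min' hex (m := t)
  have hjM := hmin M ⟨hx, by omega⟩
  generalize Nat.find hex = j at hs hmin hjM
  have hne : j ≠ x + 1 := by rintro rfl; omega
  have hgt : ∀ t, x + 1 ≤ t → t < j → walk X x < walk X t := by
    intro t h1 h2
    by_contra h3
    have := hmin t ⟨h1, by omega⟩
    omega
  refine ⟨j, hjM, by omega, by omega, ?_, hgt⟩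
  have h1 := hgt (j - 1) (by omega) (by omega)
  have h2 := walk_succ X (j - 1)
  rw [show j - 1 + 1 = j by omega] at h2
  rw [Nat.add_sub_cancel]
  omega

theorem exists_isArc_of_down {X : Finset ℕ} {x : ℕ}
    (hdown : walk X x = walk X (x + 1) + 1) : ∃ i, IsArc X i (x + 1) := by
  have hs : walk X (Nat.findGreatest (fun t => walk X t ≤ walk X (x + 1)) x) ≤ walk X (x + 1) :=
    Nat.findGreatest_spec (P := fun t => walk X t ≤ walk X (x + 1)) (Nat.zero_le x) (Nat.zero_le _)
  have hle := Nat.findGreatest_le (P := fun t => walk X t ≤ walk X (x + 1)) x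
  have hgt : ∀ t, Nat.findGreatest (fun t => walk X t ≤ walk X (x + 1)) x < t → t ≤ x →
      walk X (x + 1) < walk X t := fun t h1 h2 =>
    not_le.1 (Nat.findGreatest_is_greatest (P := fun t => walk X t ≤ walk X (x + 1)) h1 h2)
  generalize Nat.findGreatest (fun t => walk X t ≤ walk X (x + 1)) x = i at hs hle hgt
  have hne : i ≠ x := by rintro rfl; omega
  have h1 := hgt (i + 1) (by omega) (by omega)
  have h2 := walk_succ X i
  have e : walk X (x + 1) = walk X i := by omega
  refine ⟨i + 1, by omega, by omega, e, fun t h3 h4 => ?_⟩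
  rw [Nat.add_sub_cancel, ← e]
  exact hgt t (by omega) (by omega)

open Classical in
/-- The matching by the first returns of the walk of `X`. -/
noncomputable def arcs (M : ℕ) (X : Finset ℕ) : Finset (Finset ℕ) :=
  ((Icc 1 M ×ˢ Icc 1 M).filter fun p => IsArc X p.1 p.2).image fun p => {p.1, p.2}

theorem mem_arcs {M : ℕ} {X P : Finset ℕ} :
    P ∈ arcs M X ↔ ∃ i j, j ≤ M ∧ IsArc X i j ∧ P = {i, j} := by
  simp only [arcs, mem_image, mem_filter, mem_product, mem_Icc, Prod.exists]
  constructor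
  · rintro ⟨i, j, ⟨h1, h2⟩, rfl⟩
    exact ⟨i, j, h1.2.2, h2, rfl⟩
  · rintro ⟨i, j, h1, h2, rfl⟩
    have := h2.1
    have := h2.2.1
    exact ⟨i, j, ⟨⟨⟨by omega, by omega⟩, by omega, h1⟩, h2⟩, rfl⟩

theorem pair_mem_arcs {M : ℕ} {X : Finset ℕ} {i j : ℕ} (hij : i < j) :
    ({i, j} : Finset ℕ) ∈ arcs M X ↔ j ≤ M ∧ IsArc X i j := by
  rw [mem_arcs]
  constructor
  · rintro ⟨a, b, h1, h2, e⟩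
    obtain ⟨rfl, rfl⟩ := pair_eq_pair_of_lt hij h2.2.1 e
    exact ⟨h1, h2⟩
  · rintro ⟨h1, h2⟩
    exact ⟨i, j, h1, h2, rfl⟩

theorem nestedMatching_arcs {M : ℕ} {X : Finset ℕ} (hM : walk X M = 0) :
    NestedMatching M (arcs M X) := by
  refine ⟨?_, ?_, ?_⟩
  · intro P hP
    obtain ⟨i, j, hj, h, rfl⟩ := mem_arcs.1 hP
    exact ⟨i, j, h.1, h.2.1, hj, h.odd_sub, rfl⟩
  · intro P hP Q hQ x hxP hxQ
    obtain ⟨i, j, hj, h, rfl⟩ := mem_arcs.1 hP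
    obtain ⟨a, b, hb, h', rfl⟩ := mem_arcs.1 hQ
    obtain ⟨rfl, rfl⟩ := h.eq_of_common h' (by simpa using hxP) (by simpa using hxQ)
    rfl
  · intro i j hij hP a hia haj
    obtain ⟨hj, h⟩ := (pair_mem_arcs hij).1 hP
    obtain ⟨x, rfl⟩ : ∃ x, a = x + 1 := ⟨a - 1, by omega⟩
    -- Under an arc the height is positive, which excludes a flat step; an up or down step at `a` is
    -- an end of an arc, necessarily nested inside.
    rcases walk_succ X x with ⟨hw, -⟩ | ⟨hw, -⟩ | ⟨-, hw, -⟩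
    · obtain ⟨b, hb, h'⟩ := exists_isArc_of_up hM (by omega) hw
      refine ⟨_, (pair_mem_arcs h'.2.1).2 ⟨hb, h'⟩, by simp, fun t ht => ?_⟩
      have := h.nested h' hia.le haj.le
      have := h'.2.1
      simp only [mem_insert, mem_singleton] at ht
      omega
    · obtain ⟨c, h'⟩ := exists_isArc_of_down hw
      refine ⟨_, (pair_mem_arcs h'.2.1).2 ⟨by omega, h'⟩, by simp, fun t ht => ?_⟩
      have hc : i < c := by
        by_contra hc
        have := h'.nested h (by omega) hia.le
        omega
      have := h'.2.1
      simp only [mem_insert, mem_singleton] at ht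
      omega
    · have := h.2.2.2 (x + 1) hia.le haj
      omega

theorem card_straddle_cover_arcs {M : ℕ} {X : Finset ℕ} (hM : walk X M = 0) {x : ℕ} (hx : x < M)
    (hs : (straddle (arcs M X) x).card = walk X x) :
    (straddle (arcs M X) (x + 1)).card = walk X (x + 1) ∧
      (Odd (cover (arcs M X) (x + 1)).card ↔ x + 1 ∈ X) := by
  have hn := nestedMatching_arcs hM
  rcases walk_succ X x with ⟨hw, hX⟩ | ⟨hw, hX⟩ | ⟨h0, hw, hX⟩
  · obtain ⟨b, hb, h'⟩ := exists_isArc_of_up hM hx hw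
    obtain ⟨h1, h2⟩ := hn.card_of_opening h'.2.1 ((pair_mem_arcs h'.2.1).2 ⟨hb, h'⟩)
    rw [hX, h1, h2, hs, hw]
    exact ⟨rfl, Iff.rfl⟩
  · obtain ⟨c, h'⟩ := exists_isArc_of_down hw
    obtain ⟨h1, h2⟩ := hn.card_of_closing h'.2.1 ((pair_mem_arcs h'.2.1).2 ⟨hx, h'⟩)
    rw [hX, h1, hs]
    exact ⟨by omega, Iff.rfl⟩
  · have hsupp : x + 1 ∉ supp (arcs M X) := by
      intro hmem
      rcases hn.opening_or_closing hmem with ⟨k, hk, hP⟩ | ⟨k, hk, hP⟩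
      · have := ((pair_mem_arcs hk).1 hP).2.2.2.2 (x + 1) le_rfl hk
        omega
      · have := ((pair_mem_arcs hk).1 hP).2.2.2.2 x (by omega) (by omega)
        omega
    obtain ⟨h1, h2⟩ := hn.cover_of_notMem_supp hsupp
    rw [h1, h2, hs, h0, hw]
    simpa using hX

theorem card_straddle_arcs {M : ℕ} {X : Finset ℕ} (hM : walk X M = 0) {x : ℕ} (hx : x ≤ M) :
    (straddle (arcs M X) x).card = walk X x := by
  induction x with
  | zero => simp [(nestedMatching_arcs hM).straddle_eq_empty (Or.inl rfl), walk]
  | succ x ih => exact (card_straddle_cover_arcs hM hx (ih (by omega))).1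

/-! ### The bijections -/

theorem NestedMatching.bracketSum_subset {M : ℕ} {B : Finset (Finset ℕ)} (h : NestedMatching M B)
    (N : ℕ) : bracketSum N B ⊆ Icc 1 M := by
  intro x hx
  rw [h.mem_bracketSum_iff] at hx
  obtain ⟨P, hP⟩ := card_pos.1 hx.pos
  obtain ⟨i, j, hi, hij, hj, -, rfl⟩ := h.pair P (mem_filter.1 hP).1
  rw [mem_cover_pair hij] at hP
  rw [mem_Icc]
  omega

theorem bracketSum_arcs {M : ℕ} {X : Finset ℕ} (hM : walk X M = 0) (hX : X ⊆ Icc 1 M) (N : ℕ) :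
    bracketSum N (arcs M X) = X := by
  have hn := nestedMatching_arcs hM
  have key : ∀ t ∈ Icc 1 M, t ∈ bracketSum N (arcs M X) ↔ t ∈ X := by
    intro t ht
    rw [mem_Icc] at ht
    obtain ⟨x, rfl⟩ : ∃ x, t = x + 1 := ⟨t - 1, by omega⟩
    rw [hn.mem_bracketSum_iff]
    exact (card_straddle_cover_arcs hM ht.2 (card_straddle_arcs hM (by omega))).2
  ext t
  exact ⟨fun h => (key t (hn.bracketSum_subset N h)).1 h, fun h => (key t (hX h)).2 h⟩

theorem NestedMatching.last_mem_bracketSum_iff {M : ℕ} (hM : 1 ≤ M) {B : Finset (Finset ℕ)}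
    (h : NestedMatching M B) (N : ℕ) : M ∈ bracketSum N B ↔ M ∈ supp B := by
  obtain ⟨x, rfl⟩ : ∃ x, M = x + 1 := ⟨M - 1, by omega⟩
  have h0 := h.straddle_eq_empty (x := x + 1) (Or.inr le_rfl)
  rw [h.mem_bracketSum_iff]
  by_cases hx : x + 1 ∈ supp B
  · rcases h.opening_or_closing hx with ⟨k, hk, hB⟩ | ⟨k, hk, hB⟩
    · have : ({x + 1, k} : Finset ℕ) ∈ straddle B (x + 1) :=
        (mem_straddle_pair hk).2 ⟨hB, le_rfl, hk⟩
      simp [h0] at this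
    · obtain ⟨h1, h2⟩ := h.card_of_closing hk hB
      rw [h1, h2, h0]
      simpa using hx
  · obtain ⟨h1, h2⟩ := h.cover_of_notMem_supp hx
    rw [h1, ← h2, h0]
    simpa using hx

theorem mem_EPlus_zero_iff {N : ℕ} {X : Finset ℕ} :
    X ∈ EPlus N 0 ↔ X ⊆ Icc 1 (N - 1) ∧ gam X = 0 := by
  constructor
  · rintro ⟨⟨h1, -⟩, h2, h3⟩
    refine ⟨fun x hx => ?_, h2⟩
    have := mem_Icc.1 (h1 hx)
    have : x ≠ N := by rintro rfl; exact h3 hx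
    rw [mem_Icc]
    omega
  · rintro ⟨h1, h2⟩
    refine ⟨⟨h1.trans (Icc_subset_Icc_right (Nat.sub_le _ _)), even_card_of_gam_eq_zero h2⟩, h2,
      fun h => ?_⟩
    have := mem_Icc.1 (h1 h)
    omega

theorem epsPrime_eq_bracketSum {N : ℕ} {B : Finset (Finset ℕ)} (h : B ∈ XZeroPlus N) :
    epsPrime N B = bracketSum N B := by
  rw [epsPrime, if_pos h.1, if_pos h.2]

theorem bijOn_epsPrime {N : ℕ} (hN : 1 ≤ N) (hodd : Odd N) :
    Set.BijOn (epsPrime N) (XZeroPlus N) (EPlus N 0) := by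
  have hM : Even (N - 1) := Nat.Odd.sub_odd hodd odd_one
  refine ⟨fun B hB => ?_, fun B hB C hC e => ?_, fun X hX => ?_⟩
  · rw [epsPrime_eq_bracketSum hB, mem_EPlus_zero_iff]
    have h := (mem_XZeroPlus_iff hN).1 hB
    have hsub := h.bracketSum_subset N
    refine ⟨hsub, (walk_eq_zero_iff hM hsub).1 ?_⟩
    rw [walk_bracketSum h, h.straddle_eq_empty (Or.inr le_rfl), card_empty]
  · rw [epsPrime_eq_bracketSum hB, epsPrime_eq_bracketSum hC] at e
    exact ((mem_XZeroPlus_iff hN).1 hB).bracketSum_inj ((mem_XZeroPlus_iff hN).1 hC) e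
  · obtain ⟨hsub, hg⟩ := mem_EPlus_zero_iff.1 hX
    have hw := (walk_eq_zero_iff hM hsub).2 hg
    have hmem := (mem_XZeroPlus_iff hN).2 (nestedMatching_arcs hw)
    exact ⟨_, hmem, by rw [epsPrime_eq_bracketSum hmem, bracketSum_arcs hw hsub]⟩

theorem bijOn_sep {α β : Type*} {f : α → β} {s : Set α} {t : Set β} (h : Set.BijOn f s t)
    {p : α → Prop} {q : β → Prop} (hpq : ∀ a ∈ s, q (f a) ↔ p a) :
    Set.BijOn f {a | a ∈ s ∧ p a} {b | b ∈ t ∧ q b} := by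
  refine ⟨fun a ha => ⟨h.mapsTo ha.1, (hpq a ha.1).2 ha.2⟩, h.injOn.mono fun a ha => ha.1, ?_⟩
  rintro b ⟨hb, hq⟩
  obtain ⟨a, ha, rfl⟩ := h.surjOn hb
  exact ⟨a, ⟨ha, (hpq a ha).1 hq⟩, rfl⟩

end LusztigBasis

theorem mainTheorem8 (N : ℕ) (hN : 3 ≤ N) (hodd : Odd N) :
    Set.BijOn (LusztigBasis.epsPrime N) (LusztigBasis.XZeroPlus N) (LusztigBasis.EPlus N 0) ∧
    Set.BijOn (LusztigBasis.epsPrime N) (LusztigBasis.XZeroPlus' N)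
      (LusztigBasis.EZeroPlus' N) ∧
    Set.BijOn (LusztigBasis.epsPrime N) (LusztigBasis.XZeroPlus'' N)
      (LusztigBasis.EZeroPlus'' N) := by
  have h := LusztigBasis.bijOn_epsPrime (by omega) hodd
  have hlast : ∀ B ∈ LusztigBasis.XZeroPlus N,
      N - 1 ∈ LusztigBasis.epsPrime N B ↔ N - 1 ∈ LusztigBasis.supp B := fun B hB => by
    rw [LusztigBasis.epsPrime_eq_bracketSum hB]
    exact ((LusztigBasis.mem_XZeroPlus_iff (by omega)).1 hB).last_mem_bracketSum_iff (by omega) N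
  exact ⟨h, LusztigBasis.bijOn_sep h fun B hB => not_congr (hlast B hB),
    LusztigBasis.bijOn_sep h hlast⟩
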